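/- Let $\mathfrak{so}(1,3)=\{A\in M_4(\mathbb R): A^{T}\eta+\eta A=0\}$, $\eta=\mathrm{diag}(-1,1,1,1)$, with its basis of infinitesimal rotations $\eta_1,\eta_2,\eta_3$ (where $\eta_1=E_{32}-E_{23}$, $\eta_2=E_{13}-E_{31}$, $\eta_3=E_{21}-E_{12}$, rows and columns numbered $0,1,2,3$) and boosts $K_k=E_{0k}+E_{k0}$, and let $\mathfrak{so}(1,3)_{\mathbb C}$ be its complexification. A representation is a Lie algebra homomorphism into $\mathrm{End}_{\mathbb C}(V)$, for a complex vector space $V$ ($\mathbb R$-linear for $\mathfrak{so}(1,3)$, $\mathbb C$-linear for complex Lie algebras); it is irreducible if $V\neq 0$ and the only invariant complex subspaces are $0$ and $V$; two representations are equivalent if some $\mathbb C$-linear isomorphism intertwines them. For $j\in\frac12\mathbb N=\{0,\frac12,1,\dots\}$ let $V^{(j)}$ be the complex vector space with basis $|j;m\rangle$, $m=-j,-j+1,\dots,j$, on which $\mathfrak{sl}(2,\mathbb C)$ acts by $\begin{pmatrix}a&b\\c&-a\end{pmatrix}\mapsto 2aJ_3+bJ_++cJ_-$, where $J_3|j;m\rangle=m|j;m\rangle$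 and $J_\pm|j;m\rangle=\sqrt{(j\mp m)(j\pm m+1)}\,|j;m\pm1\rangle$. For $j_1,j_2\in\frac12\mathbb N$ let $V^{(j_1,j_2)}=V^{(j_1)}\otimes V^{(j_2)}$, with basis $|j_1,j_2;m_1,m_2\rangle=|j_1;m_1\rangle\otimes|j_2;m_2\rangle$, the first (second) factor of $\mathfrak{sl}(2,\mathbb C)\times\mathfrak{sl}(2,\mathbb C)$ acting on the first (second) tensor factor. Let $\Theta:\mathfrak{so}(1,3)_{\mathbb C}\to\mathfrak{sl}(2,\mathbb C)\times\mathfrak{sl}(2,\mathbb C)$ be the $\mathbb C$-linear Lie algebra homomorphism with $\frac12(\eta_k+iK_k)\mapsto(-\frac i2\sigma_k,0)$ and $\frac12(\eta_k-iK_k)\mapsto(0,-\frac i2\sigma_k)$, where $\sigma_k$ are the Pauli matrices; through $\Theta$ the space $V^{(j_1,j_2)}$ is also a representation of $\mathfrak{so}(1,3)_{\mathbb C}$ and, by restriction, of $\mathfrak{so}(1,3)$. Then: 1. $\Theta$ is an isomorphism $\mathfrak{so}(1,3)_{\mathbb C}\cong\mathfrak{sl}(2,\mathbb C)\times\mathfrak{sl}(2,\mathbb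 C)$. 2. For every complex vector space $V$, restriction is a bijection from the representations of $\mathfrak{so}(1,3)_{\mathbb C}$ on $V$ to the representations of $\mathfrak{so}(1,3)$ on $V$; a representation of $\mathfrak{so}(1,3)_{\mathbb C}$ is irreducible if and only if its restriction is, and two of them are equivalent if and only if their restrictions are. 3. For all $j_1,j_2\in\frac12\mathbb N$, $V^{(j_1,j_2)}$ is finite-dimensional, of dimension $(2j_1+1)(2j_2+1)$. 4. For each of the Lie algebras $\mathfrak{so}(1,3)$, $\mathfrak{so}(1,3)_{\mathbb C}$ and $\mathfrak{sl}(2,\mathbb C)\times\mathfrak{sl}(2,\mathbb C)$: every $V^{(j_1,j_2)}$ is irreducible, and every finite-dimensional irreducible complex representation is equivalent to $V^{(j_1,j_2)}$ for exactly one pair $(j_1,j_2)\in\frac12\mathbb N\times\frac12\mathbb N$. -/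

import Mathlib

open scoped TensorProduct

attribute [local instance] LieRing.ofAssociativeRing

namespace Lorentz

noncomputable section

/-! ### Half-integer spins and the spaces spanned by the kets -/

/-- The half-integers `0, 1/2, 1, 3/2, …`. -/
abbrev HalfInteger : Type := {j : ℚ // ∃ n : ℕ, j = (n : ℚ) / 2}

/-- The set `{-j, -j + 1, …, j - 1, j}` of magnetic quantum numbers of spin `j`. -/
def weights (j : HalfInteger) : Set ℚ :=
  {m | ∃ k : ℕ, (k : ℚ) ≤ 2 * j.1 ∧ m = -j.1 + k}

/-- The complex vector space with basis the kets `|j; m⟩`, `m = -j, …, j`. -/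
def SpinSpace (j : HalfInteger) : Type := weights j →₀ ℂ

instance (j : HalfInteger) : AddCommGroup (SpinSpace j) :=
  inferInstanceAs (AddCommGroup (weights j →₀ ℂ))

instance (j : HalfInteger) : Module ℂ (SpinSpace j) :=
  inferInstanceAs (Module ℂ (weights j →₀ ℂ))

/-- The basis `|j; m⟩`, `m = -j, …, j`, of the spin `j` space. -/
def ketBasis (j : HalfInteger) : Module.Basis (weights j) ℂ (SpinSpace j) :=
  .ofRepr (LinearEquiv.refl ℂ (weights j →₀ ℂ))

open Classical in
/-- The basis vector `|j; m⟩`, with the convention that it is zero when `m ∉ {-j, …, j}`. -/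
def ket (j : HalfInteger) (m : ℚ) : SpinSpace j :=
  if h : m ∈ weights j then ketBasis j ⟨m, h⟩ else 0

/-- `J₃ |j; m⟩ = m |j; m⟩`. -/
def J3 (j : HalfInteger) : Module.End ℂ (SpinSpace j) :=
  (ketBasis j).constr ℂ fun m : weights j => ((m.1 : ℚ) : ℂ) • ket j m.1

/-- `J₊ |j; m⟩ = √((j - m)(j + m + 1)) |j; m + 1⟩`. -/
def Jplus (j : HalfInteger) : Module.End ℂ (SpinSpace j) :=
  (ketBasis j).constr ℂ fun m : weights j =>
    ((Real.sqrt (((j.1 - m.1) * (j.1 + m.1 + 1) : ℚ) : ℝ) : ℝ) : ℂ) • ket j (m.1 + 1)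

/-- `J₋ |j; m⟩ = √((j + m)(j - m + 1)) |j; m - 1⟩`. -/
def Jminus (j : HalfInteger) : Module.End ℂ (SpinSpace j) :=
  (ketBasis j).constr ℂ fun m : weights j =>
    ((Real.sqrt (((j.1 + m.1) * (j.1 - m.1 + 1) : ℚ) : ℝ) : ℝ) : ℂ) • ket j (m.1 - 1)

theorem ket_of_mem {j : HalfInteger} {m : ℚ} (h : m ∈ weights j) :
    ket j m = ketBasis j ⟨m, h⟩ := by
  simp [ket, h]

theorem ket_of_notMem {j : HalfInteger} {m : ℚ} (h : m ∉ weights j) : ket j m = 0 := by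
  simp [ket, h]

theorem abs_le_of_mem_weights {j : HalfInteger} {m : ℚ} (h : m ∈ weights j) :
    -j.1 ≤ m ∧ m ≤ j.1 := by
  obtain ⟨k, hk, rfl⟩ := h
  have : (0 : ℚ) ≤ k := by positivity
  constructor <;> linarith

theorem add_one_mem_weights {j : HalfInteger} {m : ℚ} (h : m ∈ weights j) (hm : m ≠ j.1) :
    m + 1 ∈ weights j := by
  obtain ⟨k, hk, rfl⟩ := h
  obtain ⟨n, hn⟩ := j.2
  refine ⟨k + 1, ?_, by push_cast; ring⟩
  have h2 : 2 * j.1 = n := by rw [hn]; ring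
  rw [h2] at hk ⊢
  have h3 : k ≤ n := by exact_mod_cast hk
  rcases h3.lt_or_eq with h4 | h4
  · exact_mod_cast h4
  · exact absurd (by rw [h4]; linarith) hm

theorem sub_one_mem_weights {j : HalfInteger} {m : ℚ} (h : m ∈ weights j) (hm : m ≠ -j.1) :
    m - 1 ∈ weights j := by
  obtain ⟨k, hk, rfl⟩ := h
  cases k with
  | zero => exact absurd (by simp) hm
  | succ k =>
    refine ⟨k, ?_, by push_cast; ring⟩
    push_cast at hk
    linarith

theorem J3_ket (j : HalfInteger) (m : ℚ) : J3 j (ket j m) = (m : ℂ) • ket j m := by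
  by_cases h : m ∈ weights j
  · rw [ket_of_mem h, J3, Module.Basis.constr_basis, ket_of_mem h]
  · simp [ket_of_notMem h]

theorem Jplus_ket {j : HalfInteger} {m : ℚ} (h : m ∈ weights j) :
    Jplus j (ket j m) =
      ((Real.sqrt (((j.1 - m) * (j.1 + m + 1) : ℚ) : ℝ) : ℝ) : ℂ) • ket j (m + 1) := by
  rw [ket_of_mem h, Jplus, Module.Basis.constr_basis]

theorem Jminus_ket {j : HalfInteger} {m : ℚ} (h : m ∈ weights j) :
    Jminus j (ket j m) =
      ((Real.sqrt (((j.1 + m) * (j.1 - m + 1) : ℚ) : ℝ) : ℝ) : ℂ) • ket j (m - 1) := by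
  rw [ket_of_mem h, Jminus, Module.Basis.constr_basis]

theorem sqrt_mul_sqrt_cast {q : ℚ} (h : 0 ≤ q) :
    ((Real.sqrt (q : ℝ) : ℝ) : ℂ) * ((Real.sqrt (q : ℝ) : ℝ) : ℂ) = (q : ℂ) := by
  rw [← Complex.ofReal_mul, Real.mul_self_sqrt (by exact_mod_cast h)]
  simp

theorem Jminus_Jplus_ket {j : HalfInteger} {m : ℚ} (h : m ∈ weights j) :
    Jminus j (Jplus j (ket j m)) = (((j.1 - m) * (j.1 + m + 1) : ℚ) : ℂ) • ket j m := by
  rw [Jplus_ket h, map_smul]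
  by_cases hm : m = j.1
  · subst hm; simp
  · rw [Jminus_ket (add_one_mem_weights h hm), smul_smul,
      show (j.1 + (m + 1)) * (j.1 - (m + 1) + 1) = (j.1 - m) * (j.1 + m + 1) by ring,
      sqrt_mul_sqrt_cast, add_sub_cancel_right]
    obtain ⟨h1, h2⟩ := abs_le_of_mem_weights h
    exact mul_nonneg (by linarith) (by linarith)

theorem Jplus_Jminus_ket {j : HalfInteger} {m : ℚ} (h : m ∈ weights j) :
    Jplus j (Jminus j (ket j m)) = (((j.1 + m) * (j.1 - m + 1) : ℚ) : ℂ) • ket j m := by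
  rw [Jminus_ket h, map_smul]
  by_cases hm : m = -j.1
  · subst hm; simp
  · rw [Jplus_ket (sub_one_mem_weights h hm), smul_smul,
      show (j.1 - (m - 1)) * (j.1 + (m - 1) + 1) = (j.1 + m) * (j.1 - m + 1) by ring,
      sqrt_mul_sqrt_cast, sub_add_cancel]
    obtain ⟨h1, h2⟩ := abs_le_of_mem_weights h
    exact mul_nonneg (by linarith) (by linarith)

theorem end_ext {j : HalfInteger} {f g : Module.End ℂ (SpinSpace j)}
    (h : ∀ m ∈ weights j, f (ket j m) = g (ket j m)) : f = g := by
  refine (ketBasis j).ext fun m => ?_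
  simpa [ket_of_mem m.2] using h m.1 m.2

theorem lie_J3_Jplus (j : HalfInteger) : J3 j * Jplus j - Jplus j * J3 j = Jplus j := by
  refine end_ext fun m h => ?_
  simp only [LinearMap.sub_apply, Module.End.mul_apply, J3_ket, Jplus_ket h, map_smul, smul_smul,
    ← sub_smul]
  congr 1
  push_cast
  ring

theorem lie_J3_Jminus (j : HalfInteger) : J3 j * Jminus j - Jminus j * J3 j = -Jminus j := by
  refine end_ext fun m h => ?_
  simp only [LinearMap.sub_apply, Module.End.mul_apply, J3_ket, Jminus_ket h, map_smul, smul_smul,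
    ← sub_smul, LinearMap.neg_apply, ← neg_smul]
  congr 1
  push_cast
  ring

theorem lie_Jplus_Jminus (j : HalfInteger) :
    Jplus j * Jminus j - Jminus j * Jplus j = (2 : ℂ) • J3 j := by
  refine end_ext fun m h => ?_
  simp only [LinearMap.sub_apply, Module.End.mul_apply, Jplus_Jminus_ket h, Jminus_Jplus_ket h,
    LinearMap.smul_apply, J3_ket, smul_smul, ← sub_smul]
  congr 1
  push_cast
  ring

/-! ### Representations of `sl(2, ℂ)` and of `sl(2, ℂ) × sl(2, ℂ)` -/

/-- The complex Lie algebra `sl(2, ℂ)` of traceless `2 × 2` matrices. -/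
abbrev Sl2 : Type := LieAlgebra.SpecialLinear.sl (Fin 2) ℂ

theorem sl2_apply_one_one (x : Sl2) : x.1 1 1 = -x.1 0 0 := by
  have h : Matrix.trace x.1 = 0 := x.2
  rw [Matrix.trace_fin_two] at h
  linear_combination h

/-- The spin `j` representation of `sl(2, ℂ)`: the traceless matrix `(a, b; c, -a)` acts as
`2a J₃ + b J₊ + c J₋`. -/
def spinRep (j : HalfInteger) : Sl2 →ₗ⁅ℂ⁆ Module.End ℂ (SpinSpace j) where
  toFun x := (2 * x.1 0 0) • J3 j + x.1 0 1 • Jplus j + x.1 1 0 • Jminus j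
  map_add' x y := by
    simp only [AddMemClass.coe_add, Matrix.add_apply]
    module
  map_smul' c x := by
    simp only [SetLike.val_smul, Matrix.smul_apply, smul_eq_mul, RingHom.id_apply]
    module
  map_lie' {x y} := by
    have h1 := sub_eq_iff_eq_add.1 (lie_J3_Jplus j)
    have h2 := sub_eq_iff_eq_add.1 (lie_J3_Jminus j)
    have h3 := sub_eq_iff_eq_add.1 (lie_Jplus_Jminus j)
    simp only [LieAlgebra.SpecialLinear.sl_bracket, LieRing.of_associative_ring_bracket,
      Matrix.sub_apply, Matrix.mul_apply, Fin.sum_univ_two, sl2_apply_one_one, mul_add, add_mul,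
      smul_mul_smul_comm, h1, h2, h3]
    module

/-- The representation of `sl(2, ℂ) × sl(2, ℂ)` on `V^{(j₁,j₂)}`, the space with basis
`|j₁, j₂; m₁, m₂⟩ = |j₁; m₁⟩ ⊗ |j₂; m₂⟩`: the first factor acts on `m₁` by the spin `j₁`
representation, and the second one on `m₂` by the spin `j₂` representation. -/
def pairRep (j₁ j₂ : HalfInteger) :
    Sl2 × Sl2 →ₗ⁅ℂ⁆ Module.End ℂ (SpinSpace j₁ ⊗[ℂ] SpinSpace j₂) where
  toFun x := LinearMap.rTensor (SpinSpace j₂) (spinRep j₁ x.1) +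
    LinearMap.lTensor (SpinSpace j₁) (spinRep j₂ x.2)
  map_add' x y := by
    simp only [Prod.fst_add, Prod.snd_add, map_add, LinearMap.rTensor_add, LinearMap.lTensor_add]
    abel
  map_smul' c x := by
    simp only [Prod.smul_fst, Prod.smul_snd, map_smul, LinearMap.rTensor_smul,
      LinearMap.lTensor_smul, smul_add, RingHom.id_apply]
  map_lie' {x y} := by
    refine TensorProduct.ext' fun v w => ?_
    simp only [LieAlgebra.Prod.bracket_apply, LieHom.map_lie, LieRing.of_associative_ring_bracket,
      LinearMap.add_apply, LinearMap.sub_apply, Module.End.mul_apply, LinearMap.rTensor_tmul,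
      LinearMap.lTensor_tmul, TensorProduct.sub_tmul, TensorProduct.tmul_sub, map_add]
    abel

/-! ### The Lorentz algebra and its complexification -/

/-- The Minkowski metric `diag(-1, 1, 1, 1)`. -/
def minkowski : Matrix (Fin 4) (Fin 4) ℝ := Matrix.diagonal ![-1, 1, 1, 1]

/-- The real Lie algebra `so(1,3)` of `4 × 4` real matrices `A` with `Aᵀ η + η A = 0`, where `η` is
the Minkowski metric. -/
abbrev So13 : Type := skewAdjointMatricesLieSubalgebra minkowski

theorem mem_so13 (A : Matrix (Fin 4) (Fin 4) ℝ) :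
    A ∈ skewAdjointMatricesLieSubalgebra minkowski ↔
      A.transpose * minkowski + minkowski * A = 0 := by
  rw [mem_skewAdjointMatricesLieSubalgebra, mem_skewAdjointMatricesSubmodule,
    Matrix.IsSkewAdjoint, Matrix.IsAdjointPair, mul_neg, eq_neg_iff_add_eq_zero]

/-- The complexification `so(1,3)_ℂ`. -/
abbrev So13C : Type := ℂ ⊗[ℝ] So13

/-- The coordinate of `A` along the infinitesimal rotation `η₁`, `η₂`, `η₃`. -/
def rotation (A : So13) : Fin 3 → ℝ := ![A.1 3 2, A.1 1 3, A.1 2 1]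

/-- The coordinate of `A` along the infinitesimal boost `K₁`, `K₂`, `K₃`. -/
def boost (A : So13) : Fin 3 → ℝ := ![A.1 0 1, A.1 0 2, A.1 0 3]

/-- The combination `∑ zₖ σₖ` of the Pauli matrices. -/
def pauli (z : Fin 3 → ℂ) : Sl2 :=
  ⟨!![z 2, z 0 - Complex.I * z 1; z 0 + Complex.I * z 1, -z 2], by
    change Matrix.trace (R := ℂ) (n := Fin 2) _ = 0
    simp [Matrix.trace_fin_two]⟩

/-- `∑ θₖ ηₖ + ∑ γₖ Kₖ ↦ (∑ -(iθₖ + γₖ)/2 σₖ, ∑ -(iθₖ - γₖ)/2 σₖ)`. Its complex linear extension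
sends `η_k^{(+)} = (ηₖ + i Kₖ)/2` to `(-i σₖ/2, 0)` and `η_k^{(-)} = (ηₖ - i Kₖ)/2` to
`(0, -i σₖ/2)`. -/
def chiral : So13 →ₗ[ℝ] Sl2 × Sl2 where
  toFun A :=
    (pauli fun k => -(Complex.I * rotation A k + boost A k) / 2,
     pauli fun k => -(Complex.I * rotation A k - boost A k) / 2)
  map_add' A B := by
    ext i j <;> fin_cases i <;> fin_cases j <;>
      simp [pauli, rotation, boost] <;> ring
  map_smul' c A := by
    ext i j <;> fin_cases i <;> fin_cases j <;>
      simp [pauli, rotation, boost] <;> ring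

theorem so13_entries (A : So13) :
    A.1 0 0 = 0 ∧ A.1 1 1 = 0 ∧ A.1 2 2 = 0 ∧ A.1 3 3 = 0 ∧
    A.1 1 0 = A.1 0 1 ∧ A.1 2 0 = A.1 0 2 ∧ A.1 3 0 = A.1 0 3 ∧
    A.1 1 2 = -A.1 2 1 ∧ A.1 2 3 = -A.1 3 2 ∧ A.1 3 1 = -A.1 1 3 := by
  have h := (mem_so13 A.1).1 A.2
  have e : ∀ i j, (A.1.transpose * minkowski + minkowski * A.1) i j = 0 := fun i j => by
    rw [h]; rfl
  simp only [minkowski, Matrix.add_apply, Matrix.mul_diagonal, Matrix.diagonal_mul,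
    Matrix.transpose_apply] at e
  have e00 := e 0 0
  have e11 := e 1 1
  have e22 := e 2 2
  have e33 := e 3 3
  have e01 := e 0 1
  have e02 := e 0 2
  have e03 := e 0 3
  have e12 := e 1 2
  have e23 := e 2 3
  have e13 := e 1 3
  simp at e00 e11 e22 e33 e01 e02 e03 e12 e23 e13
  refine ⟨?_, ?_, ?_, ?_, ?_, ?_, ?_, ?_, ?_, ?_⟩ <;> linarith

theorem chiral_lie (A B : So13) : chiral ⁅A, B⁆ = ⁅chiral A, chiral B⁆ := by
  obtain ⟨a0, a1, a2, a3, a4, a5, a6, a7, a8, a9⟩ := so13_entries A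
  obtain ⟨b0, b1, b2, b3, b4, b5, b6, b7, b8, b9⟩ := so13_entries B
  ext i j <;> fin_cases i <;> fin_cases j <;>
    simp [chiral, pauli, rotation, boost, LieRing.of_associative_ring_bracket, Matrix.mul_apply, Fin.sum_univ_four,
      a0, a1, a2, a3, a4, a5, a6, a7, a8, a9,
      b0, b1, b2, b3, b4, b5, b6, b7, b8, b9] <;>
    ring_nf <;> simp only [Complex.I_sq, Complex.I_pow_three] <;> ring

/-- The complex linear extension `so(1,3)_ℂ → sl(2, ℂ) × sl(2, ℂ)` of `chiral`. -/
def chiralC : So13C →ₗ⁅ℂ⁆ Sl2 × Sl2 where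
  toLinearMap := LinearMap.liftBaseChange ℂ chiral
  map_lie' {x y} := by
    change LinearMap.liftBaseChange ℂ chiral ⁅x, y⁆ =
      ⁅LinearMap.liftBaseChange ℂ chiral x, LinearMap.liftBaseChange ℂ chiral y⁆
    induction x using TensorProduct.induction_on with
    | zero => simp
    | add x₁ x₂ h₁ h₂ => rw [add_lie, map_add, map_add, add_lie, h₁, h₂]
    | tmul a A =>
      induction y using TensorProduct.induction_on with
      | zero => rw [show ⁅a ⊗ₜ[ℝ] A, (0 : So13C)⁆ = 0 from
          lie_zero (L := So13C) (M := So13C) _, map_zero, lie_zero]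
      | add y₁ y₂ h₁ h₂ =>
        rw [show ⁅a ⊗ₜ[ℝ] A, y₁ + y₂⁆ = ⁅a ⊗ₜ[ℝ] A, y₁⁆ + ⁅a ⊗ₜ[ℝ] A, y₂⁆ from
          lie_add (L := So13C) (M := So13C) _ _ _,
          map_add, map_add, lie_add, h₁, h₂]
      | tmul b B =>
        simp only [LieAlgebra.ExtendScalars.bracket_tmul, LinearMap.liftBaseChange_tmul,
          chiral_lie, smul_lie, lie_smul, smul_smul, mul_comm a b]

/-! ### Representations, irreducibility, equivalence -/

/-- A representation of a Lie algebra `L` on a complex vector space `V`, given by the operators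
`ρ x`, is irreducible if `V ≠ 0` and the only invariant complex subspaces are `0` and `V`. -/
def IsIrreducible {L V : Type*} [AddCommGroup V] [Module ℂ V] (ρ : L → Module.End ℂ V) : Prop :=
  Nontrivial V ∧ ∀ W : Submodule ℂ V, (∀ x, ∀ w ∈ W, ρ x w ∈ W) → W = ⊥ ∨ W = ⊤

/-- Two representations are equivalent if a complex linear isomorphism intertwines them. -/
def Equivalent {L V W : Type*} [AddCommGroup V] [Module ℂ V] [AddCommGroup W] [Module ℂ W]
    (ρ : L → Module.End ℂ V) (σ : L → Module.End ℂ W) : Prop :=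
  ∃ T : V ≃ₗ[ℂ] W, ∀ x v, T (ρ x v) = σ x (T v)

/-- The restriction to `so(1,3)` of a representation of `so(1,3)_ℂ`. -/
def restrict {V : Type*} [AddCommGroup V] [Module ℂ V] (ρ : So13C →ₗ⁅ℂ⁆ Module.End ℂ V) :
    So13 →ₗ⁅ℝ⁆ Module.End ℂ V where
  toFun A := ρ (1 ⊗ₜ[ℝ] A)
  map_add' A B := by rw [TensorProduct.tmul_add, map_add]
  map_smul' c A := by
    rw [TensorProduct.tmul_smul, RingHom.id_apply, ← algebraMap_smul ℂ c, map_smul,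
      algebraMap_smul]
  map_lie' {A B} := by
    rw [← LieHom.map_lie, LieAlgebra.ExtendScalars.bracket_tmul, one_mul]

/-- The representation `V^{(j₁,j₂)}` of `so(1,3)_ℂ`. -/
def repC (j₁ j₂ : HalfInteger) :
    So13C →ₗ⁅ℂ⁆ Module.End ℂ (SpinSpace j₁ ⊗[ℂ] SpinSpace j₂) :=
  (pairRep j₁ j₂).comp chiralC

/-- The representation `V^{(j₁,j₂)}` of `so(1,3)`. -/
def rep (j₁ j₂ : HalfInteger) :
    So13 →ₗ⁅ℝ⁆ Module.End ℂ (SpinSpace j₁ ⊗[ℂ] SpinSpace j₂) :=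
  restrict (repC j₁ j₂)

end

end Lorentz

/-!
The complexification `so(1,3)_ℂ` splits because the combinations `(ηₖ ± i Kₖ)/2` of rotations and
boosts span two commuting copies of `sl(2, ℂ)`; concretely, the map `chiralC` is inverted by solving
for the rotation and boost coordinates in terms of the Pauli coordinates of the two factors
(`unchiral`). Complex representations of a real Lie algebra extend uniquely to its complexification,
with the same invariant subspaces and the same intertwining maps, because `c ⊗ A` acts as `c` times
the operator of `A` (`apply_tmul`). The classification therefore only has to be proved for
`sl(2, ℂ) × sl(2, ℂ)`.

There the argument is that of highest weights. A nonzero invariant subspace of a finite-dimensional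
representation contains a primitive vector of the first factor; those of a given weight form a
subspace preserved by the second factor, which commutes with the first one, so a vector primitive
for both factors exists, with natural numbers as weights (`exists_highest_weight_vector`).

* In `V^{(j₁,j₂)}` only the multiples of `|j₁, j₂; j₁, j₂⟩` are such vectors, and their weights are
  `2j₁` and `2j₂` (`highest_weight_vector_pairRep`). Since the lowering operators generate the whole
  space from this vector, `V^{(j₁,j₂)}` is irreducible; since an equivalence preserves highest
  weights, different pairs of spins give inequivalent representations.
* If `u` is a highest weight vector, of weights `m` and `n`, of an irreducible representation, then
  `J₋ᵏ |j₁; j₁⟩ ⊗ J₋ˡ |j₂; j₂⟩ ↦ F₁ᵏ F₂ˡ u` with `j₁ = m/2` and `j₂ = n/2` defines an intertwining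
  map from `V^{(j₁,j₂)}` (`ladder_spinRep`): in both spaces the triple acts on the lowered vectors
  by the same formulas. By Schur's lemma it is an equivalence (`exists_equivalent_pairRep`).
-/

namespace Lorentz

noncomputable section

/-! ### The standard triple of `sl(2, ℂ)` and primitive vectors -/

/-- The element `diag(1, -1)` of `sl(2, ℂ)`. -/
def slH : Sl2 := ⟨!![1, 0; 0, -1], by
  change Matrix.trace (R := ℂ) (n := Fin 2) _ = 0
  simp [Matrix.trace_fin_two]⟩

/-- The raising element of `sl(2, ℂ)`. -/
def slE : Sl2 := ⟨!![0, 1; 0, 0], by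
  change Matrix.trace (R := ℂ) (n := Fin 2) _ = 0
  simp [Matrix.trace_fin_two]⟩

/-- The lowering element of `sl(2, ℂ)`. -/
def slF : Sl2 := ⟨!![0, 0; 1, 0], by
  change Matrix.trace (R := ℂ) (n := Fin 2) _ = 0
  simp [Matrix.trace_fin_two]⟩

theorem isSl2Triple : IsSl2Triple slH slE slF where
  h_ne_zero h := by
    have := congr_fun (congr_fun (congr_arg Subtype.val h) 0) 0
    simp [slH] at this
  lie_e_f := by
    ext i j
    fin_cases i <;> fin_cases j <;>
      simp [slH, slE, slF, LieRing.of_associative_ring_bracket]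
  lie_h_e_nsmul := by
    ext i j
    fin_cases i <;> fin_cases j <;>
      simp [slH, slE, LieRing.of_associative_ring_bracket]; norm_num
  lie_h_f_nsmul := by
    ext i j
    fin_cases i <;> fin_cases j <;>
      simp [slH, slF, LieRing.of_associative_ring_bracket]; norm_num

theorem sl2_eq_combination (x : Sl2) :
    x = x.1 0 0 • slH + x.1 0 1 • slE + x.1 1 0 • slF := by
  ext i j
  fin_cases i <;> fin_cases j <;> simp [slH, slE, slF, sl2_apply_one_one]

section Primitive

variable {V : Type*} [AddCommGroup V] [Module ℂ V] (φ : Sl2 →ₗ⁅ℂ⁆ Module.End ℂ V)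

/-- The subspace of vectors of weight `μ` that are killed by the raising operator. -/
def primitives (μ : ℂ) : Submodule ℂ V :=
  (φ slH).eigenspace μ ⊓ LinearMap.ker (φ slE)

variable {φ}

theorem mem_primitives {μ : ℂ} {v : V} :
    v ∈ primitives φ μ ↔ φ slH v = μ • v ∧ φ slE v = 0 := by
  simp [primitives]

theorem slH_pow_slF {μ : ℂ} {v : V} (hv : v ∈ primitives φ μ) (k : ℕ) :
    φ slH ((φ slF ^ k) v) = (μ - 2 * k) • (φ slF ^ k) v := by
  rw [mem_primitives] at hv
  by_cases h0 : v = 0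
  · simp [h0]
  let _ := LieRingModule.compLieHom V φ
  let _ := LieModule.compLieHom V φ
  have P : isSl2Triple.HasPrimitiveVectorWith v μ := ⟨h0, hv.1, hv.2⟩
  exact P.lie_h_pow_toEnd_f k

theorem slE_pow_slF {μ : ℂ} {v : V} (hv : v ∈ primitives φ μ) (k : ℕ) :
    φ slE ((φ slF ^ (k + 1)) v) = ((k + 1) * (μ - k)) • (φ slF ^ k) v := by
  rw [mem_primitives] at hv
  by_cases h0 : v = 0
  · simp [h0]
  let _ := LieRingModule.compLieHom V φ
  let _ := LieModule.compLieHom V φ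
  have P : isSl2Triple.HasPrimitiveVectorWith v μ := ⟨h0, hv.1, hv.2⟩
  exact P.lie_e_pow_succ_toEnd_f k

theorem pow_slF_ne_zero {n : ℕ} {v : V} (hv : v ∈ primitives φ n) (h0 : v ≠ 0) {k : ℕ}
    (hk : k ≤ n) : (φ slF ^ k) v ≠ 0 := by
  rw [mem_primitives] at hv
  let _ := LieRingModule.compLieHom V φ
  let _ := LieModule.compLieHom V φ
  have P : isSl2Triple.HasPrimitiveVectorWith v (n : ℂ) := ⟨h0, hv.1, hv.2⟩
  exact P.pow_toEnd_f_ne_zero_of_eq_nat rfl hk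

variable [FiniteDimensional ℂ V]

theorem pow_slF_eq_zero {n : ℕ} {v : V} (hv : v ∈ primitives φ n) :
    (φ slF ^ (n + 1)) v = 0 := by
  rw [mem_primitives] at hv
  by_cases h0 : v = 0
  · simp [h0]
  let _ := LieRingModule.compLieHom V φ
  let _ := LieModule.compLieHom V φ
  have P : isSl2Triple.HasPrimitiveVectorWith v (n : ℂ) := ⟨h0, hv.1, hv.2⟩
  exact P.pow_toEnd_f_eq_zero_of_eq_nat rfl

theorem exists_primitive [Nontrivial V] : ∃ n : ℕ, ∃ v ∈ primitives φ n, v ≠ 0 := by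
  let _ := LieRingModule.compLieHom V φ
  let _ := LieModule.compLieHom V φ
  obtain ⟨μ, v, h0, P⟩ := IsSl2Triple.exists_hasPrimitiveVectorWith (R := ℂ) (M := V) isSl2Triple
  obtain ⟨n, rfl⟩ := P.exists_nat
  exact ⟨n, v, mem_primitives.2 ⟨P.lie_h, P.lie_e⟩, h0⟩

/-- A nonzero invariant subspace contains a primitive vector. -/
theorem exists_primitive_mem {U : Submodule ℂ V} (hU : ∀ x, ∀ u ∈ U, φ x u ∈ U) (h0 : U ≠ ⊥) :
    ∃ n : ℕ, ∃ u ∈ U, u ∈ primitives φ n ∧ u ≠ 0 := by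
  let ψ : Sl2 →ₗ⁅ℂ⁆ Module.End ℂ U :=
    { toFun := fun x => (φ x).restrict (hU x)
      map_add' := fun x y => by ext; simp
      map_smul' := fun c x => by ext; simp
      map_lie' := fun {x y} => by ext; simp [LieRing.of_associative_ring_bracket] }
  have hψ (x : Sl2) (u : U) : (ψ x u : V) = φ x u := rfl
  have := Submodule.nontrivial_iff_ne_bot.2 h0
  obtain ⟨n, u, hu, hu0⟩ := exists_primitive (φ := ψ)
  refine ⟨n, u, u.2, ?_, by simpa using hu0⟩
  rw [mem_primitives] at hu ⊢
  rw [← hψ, ← hψ, hu.1, hu.2]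
  simp

end Primitive

/-! ### The basis of `V^{(j)}` obtained by lowering the highest ket -/

theorem top_mem_weights (j : HalfInteger) : j.1 ∈ weights j := by
  obtain ⟨n, hn⟩ := j.2
  exact ⟨n, by linarith, by linarith⟩

theorem spinRep_slH (j : HalfInteger) : spinRep j slH = (2 : ℂ) • J3 j := by
  simp [spinRep, slH]

theorem spinRep_slE (j : HalfInteger) : spinRep j slE = Jplus j := by
  simp [spinRep, slE]

theorem ket_ne_zero {j : HalfInteger} {m : ℚ} (h : m ∈ weights j) : ket j m ≠ 0 := by
  rw [ket_of_mem h]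
  exact (ketBasis j).ne_zero _

theorem ket_top_mem_primitives {j : HalfInteger} {n : ℕ} (hn : j.1 = n / 2) :
    ket j j.1 ∈ primitives (spinRep j) n := by
  rw [mem_primitives, spinRep_slH, spinRep_slE, Jplus_ket (top_mem_weights j)]
  refine ⟨?_, by simp⟩
  rw [LinearMap.smul_apply, J3_ket, smul_smul, hn]
  congr 1
  push_cast
  ring

/-- The bijection `k ↦ j - k` from `{0, …, 2j}` to the weights of spin `j`. -/
def weightEquiv {j : HalfInteger} {n : ℕ} (hn : j.1 = n / 2) : Fin (n + 1) ≃ weights j :=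
  Equiv.ofBijective (fun k => ⟨j.1 - (k : ℕ), n - (k : ℕ), by
      have h : (k : ℕ) ≤ n := Nat.lt_succ_iff.1 k.2
      push_cast [Nat.cast_sub h]
      constructor <;> linarith [(Nat.cast_nonneg (k : ℕ) : (0 : ℚ) ≤ (k : ℕ))]⟩)
    ⟨fun k l h => by simpa [Fin.ext_iff] using congr_arg Subtype.val h, fun m => by
      obtain ⟨m, k, hk, rfl⟩ := m
      have h : k ≤ n := by
        have : (k : ℚ) ≤ n := by linarith
        exact_mod_cast this
      refine ⟨⟨n - k, by lia⟩, Subtype.ext ?_⟩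
      push_cast [Nat.cast_sub h]
      linarith⟩

theorem finrank_spinSpace {j : HalfInteger} {n : ℕ} (hn : j.1 = n / 2) :
    Module.finrank ℂ (SpinSpace j) = n + 1 := by
  rw [Module.finrank_eq_nat_card_basis (ketBasis j), ← Nat.card_congr (weightEquiv hn),
    Nat.card_fin]

instance (j : HalfInteger) : FiniteDimensional ℂ (SpinSpace j) := by
  obtain ⟨n, hn⟩ := j.2
  have := Finite.of_equiv _ (weightEquiv hn)
  exact Module.Finite.of_basis (ketBasis j)

/-- The basis of `V^{(j)}` formed by the vectors `J₋ᵏ |j; j⟩`, `k = 0, …, 2j`, where `J₋` is the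
action of `slF`. It is used in place of the kets because it involves no square roots. -/
def lowerBasis {j : HalfInteger} {n : ℕ} (hn : j.1 = n / 2) :
    Module.Basis (Fin (n + 1)) ℂ (SpinSpace j) :=
  basisOfLinearIndependentOfCardEqFinrank
    (b := fun k : Fin (n + 1) => (spinRep j slF ^ (k : ℕ)) (ket j j.1))
    (Module.End.eigenvectors_linearIndependent' (spinRep j slH)
      (fun k : Fin (n + 1) => (n : ℂ) - 2 * (k : ℕ))
      (fun k l h => by simpa [Fin.ext_iff] using h) _ fun k =>
      ⟨Module.End.mem_eigenspace_iff.2 (slH_pow_slF (ket_top_mem_primitives hn) k),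
        pow_slF_ne_zero (ket_top_mem_primitives hn) (ket_ne_zero (top_mem_weights j))
          (Nat.lt_succ_iff.1 k.2)⟩)
    (by rw [Fintype.card_fin, finrank_spinSpace hn])

theorem lowerBasis_apply {j : HalfInteger} {n : ℕ} (hn : j.1 = n / 2) (k : Fin (n + 1)) :
    lowerBasis hn k = (spinRep j slF ^ (k : ℕ)) (ket j j.1) := by
  simp [lowerBasis]

/-- Induction on a vector of `V^{(j)}`, along the basis of the lowered highest kets. -/
theorem lowering_induction {j : HalfInteger} {n : ℕ} (hn : j.1 = n / 2) {p : SpinSpace j → Prop}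
    (add : ∀ x y, p x → p y → p (x + y)) (smul : ∀ (c : ℂ) x, p x → p (c • x))
    (pow : ∀ k ≤ n, p ((spinRep j slF ^ k) (ket j j.1))) (x : SpinSpace j) : p x := by
  have hx : x ∈ Submodule.span ℂ (Set.range (lowerBasis hn)) := by simp [(lowerBasis hn).span_eq]
  induction hx using Submodule.span_induction with
  | mem x hx =>
    obtain ⟨k, rfl⟩ := hx
    rw [lowerBasis_apply]
    exact pow k (Nat.lt_succ_iff.1 k.2)
  | zero => simpa using smul 0 _ (pow 0 n.zero_le)
  | add x y _ _ hx hy => exact add x y hx hy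
  | smul c x _ hx => exact smul c x hx

section Ladder

variable {V : Type*} [AddCommGroup V] [Module ℂ V]

/-- The linear map taking `J₋ᵏ |j; j⟩` to the power `fᵏ` of a given operator `f`. If `f` is the
lowering operator of a representation with a primitive vector `v` of weight `2j`, then evaluation
at `v` turns it into an intertwining map from `V^{(j)}`. -/
def ladder {j : HalfInteger} {n : ℕ} (hn : j.1 = n / 2) (f : Module.End ℂ V) :
    SpinSpace j →ₗ[ℂ] Module.End ℂ V :=
  (lowerBasis hn).constr ℂ fun k => f ^ (k : ℕ)

theorem ladder_pow {j : HalfInteger} {n : ℕ} (hn : j.1 = n / 2) (f : Module.End ℂ V) {k : ℕ}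
    (hk : k ≤ n) : ladder hn f ((spinRep j slF ^ k) (ket j j.1)) = f ^ k := by
  have h := (lowerBasis hn).constr_basis ℂ (fun k => f ^ (k : ℕ)) ⟨k, Nat.lt_succ_iff.2 hk⟩
  rwa [lowerBasis_apply] at h

theorem ladder_top {j : HalfInteger} {n : ℕ} (hn : j.1 = n / 2) (f : Module.End ℂ V) :
    ladder hn f (ket j j.1) = 1 := by
  simpa using ladder_pow hn f (Nat.zero_le n)

theorem commute_ladder {j : HalfInteger} {n : ℕ} (hn : j.1 = n / 2) {f g : Module.End ℂ V}
    (h : Commute g f) (x : SpinSpace j) : Commute g (ladder hn f x) := by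
  induction x using lowering_induction hn with
  | add x y hx hy => rw [map_add]; exact hx.add_right hy
  | smul c x hx => rw [map_smul]; exact hx.smul_right c
  | pow k hk =>
    rw [ladder_pow hn f hk]
    exact h.pow_right _

/-- Evaluation of the ladder at a primitive vector intertwines. -/
theorem ladder_spinRep [FiniteDimensional ℂ V] {φ : Sl2 →ₗ⁅ℂ⁆ Module.End ℂ V} {j : HalfInteger}
    {n : ℕ} (hn : j.1 = n / 2) {v : V} (hv : v ∈ primitives φ n) (x : Sl2) (y : SpinSpace j) :
    ladder hn (φ slF) (spinRep j x y) v = φ x (ladder hn (φ slF) y v) := by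
  induction y using lowering_induction hn with
  | add y z hy hz => simp [hy, hz]
  | smul c y hy => simp [hy]
  | pow k hk =>
    have ht := ket_top_mem_primitives hn
    rw [ladder_pow hn _ hk]
    have hH : ladder hn (φ slF) (spinRep j slH ((spinRep j slF ^ k) (ket j j.1))) v =
        φ slH ((φ slF ^ k) v) := by
      rw [slH_pow_slF ht, slH_pow_slF hv, map_smul, ladder_pow hn _ hk, LinearMap.smul_apply]
    have hE : ladder hn (φ slF) (spinRep j slE ((spinRep j slF ^ k) (ket j j.1))) v =
        φ slE ((φ slF ^ k) v) := by
      cases k with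
      | zero => simp [(mem_primitives.1 ht).2, (mem_primitives.1 hv).2]
      | succ k =>
        rw [slE_pow_slF ht, slE_pow_slF hv, map_smul, ladder_pow hn _ (by lia),
          LinearMap.smul_apply]
    have hF : ladder hn (φ slF) (spinRep j slF ((spinRep j slF ^ k) (ket j j.1))) v =
        φ slF ((φ slF ^ k) v) := by
      rw [← Module.End.mul_apply, ← pow_succ', ← Module.End.mul_apply (φ slF), ← pow_succ']
      rcases hk.lt_or_eq with h | rfl
      · rw [ladder_pow hn _ h]
      · rw [pow_slF_eq_zero ht, pow_slF_eq_zero hv, map_zero, LinearMap.zero_apply]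
    rw [sl2_eq_combination x]
    simp only [map_add, map_smul, LinearMap.add_apply, LinearMap.smul_apply, hH, hE, hF]

end Ladder

/-! ### Highest weight vectors of representations of `sl(2, ℂ) × sl(2, ℂ)` -/

section Factors

variable {V : Type*} [AddCommGroup V] [Module ℂ V] (ρ : Sl2 × Sl2 →ₗ⁅ℂ⁆ Module.End ℂ V)

/-- The representation of the first factor of `sl(2, ℂ) × sl(2, ℂ)`. -/
def leftRep : Sl2 →ₗ⁅ℂ⁆ Module.End ℂ V := ρ.comp (LieHom.inl ℂ Sl2 Sl2)

/-- The representation of the second factor of `sl(2, ℂ) × sl(2, ℂ)`. -/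
def rightRep : Sl2 →ₗ⁅ℂ⁆ Module.End ℂ V := ρ.comp (LieHom.inr ℂ Sl2 Sl2)

theorem leftRep_apply (x : Sl2) : leftRep ρ x = ρ (x, 0) := rfl

theorem rightRep_apply (x : Sl2) : rightRep ρ x = ρ (0, x) := rfl

theorem apply_eq_leftRep_add_rightRep (x : Sl2 × Sl2) :
    ρ x = leftRep ρ x.1 + rightRep ρ x.2 := by
  rw [leftRep_apply, rightRep_apply, ← map_add]
  simp

theorem commute_leftRep_rightRep (x y : Sl2) : Commute (leftRep ρ x) (rightRep ρ y) := by
  have h : ⁅leftRep ρ x, rightRep ρ y⁆ = 0 := by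
    rw [leftRep_apply, rightRep_apply, ← LieHom.map_lie]
    simp [← Prod.zero_eq_mk]
  exact sub_eq_zero.1 h

variable {ρ}

theorem exists_highest_weight_vector [FiniteDimensional ℂ V] {W : Submodule ℂ V}
    (hW : ∀ x, ∀ w ∈ W, ρ x w ∈ W) (h0 : W ≠ ⊥) :
    ∃ m n : ℕ, ∃ w ∈ W, w ∈ primitives (leftRep ρ) m ∧ w ∈ primitives (rightRep ρ) n ∧ w ≠ 0 := by
  obtain ⟨m, v, hvW, hv, hv0⟩ := exists_primitive_mem (φ := leftRep ρ) (fun x => hW (x, 0)) h0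
  -- The second factor commutes with the first one, so it preserves the primitive vectors of it.
  obtain ⟨n, w, ⟨hwW, hw⟩, hwn, hw0⟩ :=
    exists_primitive_mem (φ := rightRep ρ) (U := W ⊓ primitives (leftRep ρ) m)
      (fun x w hw => by
        refine ⟨hW (0, x) w hw.1, ?_⟩
        have h := mem_primitives.1 hw.2
        have hc (y : Sl2) : leftRep ρ y (rightRep ρ x w) = rightRep ρ x (leftRep ρ y w) :=
          LinearMap.congr_fun (commute_leftRep_rightRep ρ y x).eq w
        rw [SetLike.mem_coe, mem_primitives, hc, hc, h.1, h.2, map_smul, map_zero]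
        exact ⟨rfl, rfl⟩)
      ((Submodule.ne_bot_iff _).2 ⟨v, ⟨hvW, hv⟩, hv0⟩)
  exact ⟨m, n, w, hwW, hw, hwn, hw0⟩

end Factors

theorem leftRep_pairRep_tmul {j₁ j₂ : HalfInteger} (x : Sl2) (v : SpinSpace j₁)
    (w : SpinSpace j₂) : leftRep (pairRep j₁ j₂) x (v ⊗ₜ w) = spinRep j₁ x v ⊗ₜ[ℂ] w := by
  simp [leftRep_apply, pairRep]

theorem rightRep_pairRep_tmul {j₁ j₂ : HalfInteger} (x : Sl2) (v : SpinSpace j₁)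
    (w : SpinSpace j₂) : rightRep (pairRep j₁ j₂) x (v ⊗ₜ w) = v ⊗ₜ[ℂ] spinRep j₂ x w := by
  simp [rightRep_apply, pairRep]

/-- In a basis of eigenvectors, an eigenvector only has coordinates along the basis vectors with
the same eigenvalue. -/
theorem eigenvalue_eq_of_repr_ne_zero {ι V : Type*} [AddCommGroup V] [Module ℂ V]
    (b : Module.Basis ι ℂ V) {f : Module.End ℂ V} {a : ι → ℂ} (hf : ∀ i, f (b i) = a i • b i)
    {μ : ℂ} {w : V} (hw : f w = μ • w) {i : ι} (hi : b.repr w i ≠ 0) : a i = μ := by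
  have h : b.coord i ∘ₗ f = a i • b.coord i := by
    refine b.ext fun k => ?_
    by_cases hk : k = i
    · simp [hf, hk]
    · simp [hf, hk]
  have h' := LinearMap.congr_fun h w
  simp only [LinearMap.comp_apply, hw, map_smul, LinearMap.smul_apply, Module.Basis.coord_apply,
    smul_eq_mul] at h'
  exact (mul_right_cancel₀ hi h').symm

theorem ket_top_tmul_ne_zero (j₁ j₂ : HalfInteger) :
    ket j₁ j₁.1 ⊗ₜ[ℂ] ket j₂ j₂.1 ≠ 0 := by
  rw [ket_of_mem (top_mem_weights j₁), ket_of_mem (top_mem_weights j₂),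
    ← Module.Basis.tensorProduct_apply]
  exact Module.Basis.ne_zero _ _

/-- The only highest weight vectors of `V^{(j₁,j₂)}` are the multiples of `|j₁, j₂; j₁, j₂⟩`. -/
theorem highest_weight_vector_pairRep {j₁ j₂ : HalfInteger} {n₁ n₂ p q : ℕ} (h₁ : j₁.1 = n₁ / 2)
    (h₂ : j₂.1 = n₂ / 2) {w : SpinSpace j₁ ⊗[ℂ] SpinSpace j₂} (h0 : w ≠ 0)
    (hl : w ∈ primitives (leftRep (pairRep j₁ j₂)) p)
    (hr : w ∈ primitives (rightRep (pairRep j₁ j₂)) q) :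
    p = n₁ ∧ q = n₂ ∧ ∃ c : ℂ, w = c • (ket j₁ j₁.1 ⊗ₜ ket j₂ j₂.1) := by
  have t₁ := ket_top_mem_primitives h₁
  have t₂ := ket_top_mem_primitives h₂
  rw [mem_primitives] at hl hr
  let b := (lowerBasis h₁).tensorProduct (lowerBasis h₂)
  have hb (i) : b i = (spinRep j₁ slF ^ (i.1 : ℕ)) (ket j₁ j₁.1) ⊗ₜ
      (spinRep j₂ slF ^ (i.2 : ℕ)) (ket j₂ j₂.1) := by
    simp [b, Module.Basis.tensorProduct_apply', lowerBasis_apply]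
  have hbl (i) : leftRep (pairRep j₁ j₂) slH (b i) = ((n₁ : ℂ) - 2 * (i.1 : ℕ)) • b i := by
    rw [hb, leftRep_pairRep_tmul, slH_pow_slF t₁, TensorProduct.smul_tmul']
  have hbr (i) : rightRep (pairRep j₁ j₂) slH (b i) = ((n₂ : ℂ) - 2 * (i.2 : ℕ)) • b i := by
    rw [hb, rightRep_pairRep_tmul, slH_pow_slF t₂, TensorProduct.tmul_smul]
  have key (i) (hi : b.repr w i ≠ 0) :
      (n₁ : ℂ) - 2 * (i.1 : ℕ) = p ∧ (n₂ : ℂ) - 2 * (i.2 : ℕ) = q :=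
    ⟨eigenvalue_eq_of_repr_ne_zero b hbl hl.1 hi, eigenvalue_eq_of_repr_ne_zero b hbr hr.1 hi⟩
  obtain ⟨i, hi⟩ : ∃ i, b.repr w i ≠ 0 := by
    by_contra! h
    exact h0 (b.repr.map_eq_zero_iff.1 (Finsupp.ext h))
  have hi' := key i hi
  -- The joint weights of the basis vectors are distinct, so only one coordinate is nonzero.
  have hw : w = b.repr w i • b i := by
    conv_lhs => rw [← b.sum_repr w]
    refine Finset.sum_eq_single i (fun k _ hk => ?_) (by simp)
    by_contra! hne
    have hk' := key k fun h => hne (by rw [h, zero_smul])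
    refine hk (Prod.ext (Fin.ext ?_) (Fin.ext ?_))
    · have := hk'.1.trans hi'.1.symm
      simpa using this
    · have := hk'.2.trans hi'.2.symm
      simpa using this
  obtain ⟨⟨k, hk⟩, ⟨l, hl'⟩⟩ := i
  -- The raising operator of either factor kills only the highest vector of the basis.
  have hk0 : k = 0 := by
    cases k with
    | zero => rfl
    | succ k =>
      have hne := b.ne_zero (⟨k, by lia⟩, ⟨l, hl'⟩)
      have h := hl.2
      rw [hb] at hne
      rw [hw, map_smul, smul_eq_zero_iff_right hi, hb, leftRep_pairRep_tmul, slE_pow_slF t₁,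
        ← TensorProduct.smul_tmul', smul_eq_zero_iff_left hne, mul_eq_zero, sub_eq_zero] at h
      norm_cast at h
      lia
  have hl0 : l = 0 := by
    cases l with
    | zero => rfl
    | succ l =>
      have hne := b.ne_zero (⟨k, hk⟩, ⟨l, by lia⟩)
      have h := hr.2
      rw [hb] at hne
      rw [hw, map_smul, smul_eq_zero_iff_right hi, hb, rightRep_pairRep_tmul, slE_pow_slF t₂,
        TensorProduct.tmul_smul, smul_eq_zero_iff_left hne, mul_eq_zero, sub_eq_zero] at h
      norm_cast at h
      lia
  subst hk0 hl0
  refine ⟨?_, ?_, _, by simpa [hb] using hw⟩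
  · simpa using hi'.1.symm
  · simpa using hi'.2.symm

theorem ket_top_tmul_mem_primitives {j₁ j₂ : HalfInteger} {n₁ n₂ : ℕ} (h₁ : j₁.1 = n₁ / 2)
    (h₂ : j₂.1 = n₂ / 2) :
    ket j₁ j₁.1 ⊗ₜ ket j₂ j₂.1 ∈ primitives (leftRep (pairRep j₁ j₂)) n₁ ∧
    ket j₁ j₁.1 ⊗ₜ ket j₂ j₂.1 ∈ primitives (rightRep (pairRep j₁ j₂)) n₂ := by
  have t₁ := mem_primitives.1 (ket_top_mem_primitives h₁)
  have t₂ := mem_primitives.1 (ket_top_mem_primitives h₂)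
  simp only [mem_primitives, leftRep_pairRep_tmul, rightRep_pairRep_tmul, t₁.1, t₁.2, t₂.1, t₂.2,
    TensorProduct.smul_tmul', TensorProduct.tmul_smul, TensorProduct.zero_tmul,
    TensorProduct.tmul_zero, and_self]

/-! ### The classification for `sl(2, ℂ) × sl(2, ℂ)` -/

theorem isIrreducible_pairRep (j₁ j₂ : HalfInteger) : IsIrreducible ⇑(pairRep j₁ j₂) := by
  obtain ⟨n₁, h₁⟩ := j₁.2
  obtain ⟨n₂, h₂⟩ := j₂.2
  refine ⟨⟨_, 0, ket_top_tmul_ne_zero j₁ j₂⟩, fun W hW => or_iff_not_imp_left.2 fun h0 => ?_⟩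
  obtain ⟨p, q, w, hwW, hl, hr, hw0⟩ := exists_highest_weight_vector hW h0
  obtain ⟨-, -, c, rfl⟩ := highest_weight_vector_pairRep h₁ h₂ hw0 hl hr
  have ht : ket j₁ j₁.1 ⊗ₜ ket j₂ j₂.1 ∈ W :=
    (W.smul_mem_iff fun hc => hw0 (by rw [hc, zero_smul])).1 hwW
  have hx (x : SpinSpace j₁) : x ⊗ₜ ket j₂ j₂.1 ∈ W := by
    induction x using lowering_induction h₁ with
    | add x y hx hy => rw [TensorProduct.add_tmul]; exact W.add_mem hx hy
    | smul c x hx => rw [← TensorProduct.smul_tmul']; exact W.smul_mem c hx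
    | pow k hk =>
      clear hk
      induction k with
      | zero => simpa using ht
      | succ k ih =>
        rw [pow_succ', Module.End.mul_apply, ← leftRep_pairRep_tmul]
        exact hW _ _ ih
  have hxy (x : SpinSpace j₁) (y : SpinSpace j₂) : x ⊗ₜ y ∈ W := by
    induction y using lowering_induction h₂ with
    | add y z hy hz => rw [TensorProduct.tmul_add]; exact W.add_mem hy hz
    | smul c y hy => rw [TensorProduct.tmul_smul]; exact W.smul_mem c hy
    | pow k hk =>
      clear hk
      induction k with
      | zero => simpa using hx x
      | succ k ih =>
        rw [pow_succ', Module.End.mul_apply, ← rightRep_pairRep_tmul]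
        exact hW _ _ ih
  rw [eq_top_iff, ← TensorProduct.span_tmul_eq_top, Submodule.span_le]
  rintro _ ⟨x, y, rfl⟩
  exact hxy x y

/-- Schur's lemma: a nonzero intertwining map between irreducible representations is an
equivalence. -/
theorem equivalent_of_intertwining {L V W : Type*} [AddCommGroup V] [Module ℂ V] [AddCommGroup W]
    [Module ℂ W] {ρ : L → Module.End ℂ V} {σ : L → Module.End ℂ W} (hρ : IsIrreducible ρ)
    (hσ : IsIrreducible σ) (T : V →ₗ[ℂ] W) (hT : ∀ x v, T (ρ x v) = σ x (T v)) (h0 : T ≠ 0) :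
    Equivalent ρ σ := by
  have hker : LinearMap.ker T = ⊥ := by
    refine (hρ.2 _ fun x v hv => ?_).resolve_right fun h => h0 (LinearMap.ker_eq_top.1 h)
    rw [LinearMap.mem_ker] at hv ⊢
    rw [hT, hv, map_zero]
  have hrange : LinearMap.range T = ⊤ := by
    refine (hσ.2 _ ?_).resolve_left fun h => h0 (LinearMap.range_eq_bot.1 h)
    rintro x _ ⟨v, rfl⟩
    exact ⟨ρ x v, hT x v⟩
  exact ⟨LinearEquiv.ofBijective T ⟨LinearMap.ker_eq_bot.1 hker, LinearMap.range_eq_top.1 hrange⟩,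
    hT⟩

theorem Equivalent.symm {L V W : Type*} [AddCommGroup V] [Module ℂ V] [AddCommGroup W]
    [Module ℂ W] {ρ : L → Module.End ℂ V} {σ : L → Module.End ℂ W} (h : Equivalent ρ σ) :
    Equivalent σ ρ := by
  obtain ⟨T, hT⟩ := h
  exact ⟨T.symm, fun x w => by rw [LinearEquiv.symm_apply_eq, hT, LinearEquiv.apply_symm_apply]⟩

theorem Equivalent.trans {L V W X : Type*} [AddCommGroup V] [Module ℂ V] [AddCommGroup W]
    [Module ℂ W] [AddCommGroup X] [Module ℂ X] {ρ : L → Module.End ℂ V} {σ : L → Module.End ℂ W}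
    {τ : L → Module.End ℂ X} (h : Equivalent ρ σ) (h' : Equivalent σ τ) : Equivalent ρ τ := by
  obtain ⟨T, hT⟩ := h
  obtain ⟨S, hS⟩ := h'
  exact ⟨T.trans S, fun x v => by simp [hT, hS]⟩

theorem exists_equivalent_pairRep {V : Type*} [AddCommGroup V] [Module ℂ V]
    [FiniteDimensional ℂ V] {ρ : Sl2 × Sl2 →ₗ⁅ℂ⁆ Module.End ℂ V} (hρ : IsIrreducible ⇑ρ) :
    ∃ j₁ j₂ : HalfInteger, Equivalent ⇑ρ ⇑(pairRep j₁ j₂) := by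
  have := hρ.1
  obtain ⟨m, n, u, -, hl, hr, hu0⟩ :=
    exists_highest_weight_vector (ρ := ρ) (W := ⊤) (fun _ _ _ => trivial) top_ne_bot
  let j₁ : HalfInteger := ⟨m / 2, m, rfl⟩
  let j₂ : HalfInteger := ⟨n / 2, n, rfl⟩
  have h₁ : j₁.1 = m / 2 := rfl
  have h₂ : j₂.1 = n / 2 := rfl
  refine ⟨j₁, j₂, Equivalent.symm ?_⟩
  let A := ladder h₁ (leftRep ρ slF)
  let B := ladder h₂ (rightRep ρ slF)
  -- The intertwining map sends `J₋ᵏ |j₁; j₁⟩ ⊗ J₋ˡ |j₂; j₂⟩` to `F₁ᵏ F₂ˡ u`.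
  let T : SpinSpace j₁ ⊗[ℂ] SpinSpace j₂ →ₗ[ℂ] V :=
    TensorProduct.lift ((LinearMap.lcomp ℂ V (B.flip u)) ∘ₗ A)
  have hT (x y) : T (x ⊗ₜ y) = A x (B y u) := rfl
  have hB (y) : B y u ∈ primitives (leftRep ρ) m := by
    have hc (z : Sl2) : leftRep ρ z (B y u) = B y (leftRep ρ z u) :=
      LinearMap.congr_fun (commute_ladder h₂ (commute_leftRep_rightRep ρ z slF) y).eq u
    have h := mem_primitives.1 hl
    rw [mem_primitives, hc, hc, h.1, h.2, map_smul, map_zero]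
    exact ⟨rfl, rfl⟩
  refine equivalent_of_intertwining (isIrreducible_pairRep j₁ j₂) hρ T (fun z w => ?_) fun h => ?_
  · induction w with
    | zero => simp
    | add v w hv hw => simp only [map_add, hv, hw]
    | tmul x y =>
      have hA : rightRep ρ z.2 (A x (B y u)) = A x (rightRep ρ z.2 (B y u)) :=
        LinearMap.congr_fun
          (commute_ladder h₁ (commute_leftRep_rightRep ρ slF z.2).symm x).eq (B y u)
      rw [apply_eq_leftRep_add_rightRep (pairRep j₁ j₂), apply_eq_leftRep_add_rightRep ρ,
        LinearMap.add_apply, LinearMap.add_apply, map_add, leftRep_pairRep_tmul,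
        rightRep_pairRep_tmul, hT, hT, hT, hA]
      congr 1
      · exact ladder_spinRep h₁ (hB y) z.1 x
      · exact congr_arg (A x) (ladder_spinRep h₂ hr z.2 y)
  · have h' := LinearMap.congr_fun h (ket j₁ j₁.1 ⊗ₜ ket j₂ j₂.1)
    rw [hT] at h'
    simp only [A, B, ladder_top] at h'
    exact hu0 h'

/-- The spins can be read off the weights of a highest weight vector. -/
theorem eq_of_equivalent_pairRep {j₁ j₂ k₁ k₂ : HalfInteger}
    (h : Equivalent ⇑(pairRep j₁ j₂) ⇑(pairRep k₁ k₂)) : j₁ = k₁ ∧ j₂ = k₂ := by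
  obtain ⟨T, hT⟩ := h
  obtain ⟨n₁, hn₁⟩ := j₁.2
  obtain ⟨n₂, hn₂⟩ := j₂.2
  obtain ⟨m₁, hm₁⟩ := k₁.2
  obtain ⟨m₂, hm₂⟩ := k₂.2
  obtain ⟨hl, hr⟩ := ket_top_tmul_mem_primitives hn₁ hn₂
  rw [mem_primitives] at hl hr
  obtain ⟨rfl, rfl, -⟩ := highest_weight_vector_pairRep hm₁ hm₂
    (p := n₁) (q := n₂) (w := T (ket j₁ j₁.1 ⊗ₜ ket j₂ j₂.1))
    (by simpa using ket_top_tmul_ne_zero j₁ j₂)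
    (by
      rw [mem_primitives, leftRep_apply, leftRep_apply, ← hT, ← hT, ← leftRep_apply,
        ← leftRep_apply, hl.1, hl.2, map_smul, map_zero]
      exact ⟨rfl, rfl⟩)
    (by
      rw [mem_primitives, rightRep_apply, rightRep_apply, ← hT, ← hT, ← rightRep_apply,
        ← rightRep_apply, hr.1, hr.2, map_smul, map_zero]
      exact ⟨rfl, rfl⟩)
  exact ⟨Subtype.ext (hn₁.trans hm₁.symm), Subtype.ext (hn₂.trans hm₂.symm)⟩

theorem existsUnique_equivalent_pairRep {V : Type*} [AddCommGroup V] [Module ℂ V]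
    [FiniteDimensional ℂ V] {ρ : Sl2 × Sl2 →ₗ⁅ℂ⁆ Module.End ℂ V} (hρ : IsIrreducible ⇑ρ) :
    ∃! j : HalfInteger × HalfInteger, Equivalent ⇑ρ ⇑(pairRep j.1 j.2) := by
  obtain ⟨j₁, j₂, h⟩ := exists_equivalent_pairRep hρ
  refine ⟨(j₁, j₂), h, fun k hk => ?_⟩
  obtain ⟨e₁, e₂⟩ := eq_of_equivalent_pairRep (hk.symm.trans h)
  exact Prod.ext e₁ e₂

/-! ### The isomorphism `so(1,3)_ℂ ≅ sl(2, ℂ) × sl(2, ℂ)` -/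

/-- The element `∑ θₖ ηₖ + ∑ γₖ Kₖ` of `so(1,3)`. -/
def so13Of (θ γ : Fin 3 → ℝ) : So13 :=
  ⟨!![0, γ 0, γ 1, γ 2; γ 0, 0, -θ 2, θ 1; γ 1, θ 2, 0, -θ 0; γ 2, -θ 1, θ 0, 0], by
    rw [mem_so13]
    ext i j
    fin_cases i <;> fin_cases j <;>
      simp [minkowski, Matrix.mul_apply, Matrix.diagonal]⟩

theorem rotation_so13Of (θ γ : Fin 3 → ℝ) : rotation (so13Of θ γ) = θ := by
  ext k
  fin_cases k <;> simp [rotation, so13Of]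

theorem boost_so13Of (θ γ : Fin 3 → ℝ) : boost (so13Of θ γ) = γ := by
  ext k
  fin_cases k <;> simp [boost, so13Of]

theorem so13_ext {A B : So13} (h₁ : rotation A = rotation B) (h₂ : boost A = boost B) :
    A = B := by
  obtain ⟨a0, a1, a2, a3, a4, a5, a6, a7, a8, a9⟩ := so13_entries A
  obtain ⟨b0, b1, b2, b3, b4, b5, b6, b7, b8, b9⟩ := so13_entries B
  have r0 := congr_fun h₁ 0
  have r1 := congr_fun h₁ 1
  have r2 := congr_fun h₁ 2
  have s0 := congr_fun h₂ 0
  have s1 := congr_fun h₂ 1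
  have s2 := congr_fun h₂ 2
  simp [rotation, boost] at r0 r1 r2 s0 s1 s2
  ext i j
  fin_cases i <;> fin_cases j <;> simp [*]

/-- The coordinates of an element of `sl(2, ℂ)` in the basis of the Pauli matrices. -/
def pauliCoord : Sl2 →ₗ[ℂ] Fin 3 → ℂ where
  toFun x := ![(x.1 0 1 + x.1 1 0) / 2, Complex.I * (x.1 0 1 - x.1 1 0) / 2, x.1 0 0]
  map_add' x y := by
    ext k
    fin_cases k <;> simp <;> ring
  map_smul' c x := by
    ext k
    fin_cases k <;> simp <;> ring

theorem pauliCoord_pauli (z : Fin 3 → ℂ) : pauliCoord (pauli z) = z := by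
  ext k
  fin_cases k <;> simp [pauliCoord, pauli] <;> ring_nf <;> simp

theorem pauli_pauliCoord (x : Sl2) : pauli (pauliCoord x) = x := by
  ext i j
  fin_cases i <;> fin_cases j <;>
    simp [pauliCoord, pauli, sl2_apply_one_one] <;> ring_nf <;> simp <;> ring

/-- The inverse of `chiralC`. In Pauli coordinates `chiral` is `x = -(iθ + γ)/2`,
`y = -(iθ - γ)/2`, so that `θ = i(x + y)` and `γ = y - x`. -/
def unchiral : Sl2 × Sl2 →ₗ[ℂ] So13C where
  toFun x := ∑ k, ((Complex.I * (pauliCoord x.1 k + pauliCoord x.2 k)) ⊗ₜ[ℝ]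
      so13Of (Pi.single k 1) 0 +
    (pauliCoord x.2 k - pauliCoord x.1 k) ⊗ₜ[ℝ] so13Of 0 (Pi.single k 1))
  map_add' x y := by
    rw [← Finset.sum_add_distrib]
    refine Finset.sum_congr rfl fun k _ => ?_
    rw [add_add_add_comm, ← TensorProduct.add_tmul, ← TensorProduct.add_tmul]
    simp only [Prod.fst_add, Prod.snd_add, map_add, Pi.add_apply]
    congr 2 <;> ring
  map_smul' c x := by
    rw [RingHom.id_apply, Finset.smul_sum]
    refine Finset.sum_congr rfl fun k _ => ?_
    rw [smul_add, TensorProduct.smul_tmul', TensorProduct.smul_tmul']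
    simp only [Prod.smul_fst, Prod.smul_snd, map_smul, Pi.smul_apply, smul_eq_mul]
    congr 2 <;> ring

theorem unchiral_chiral (A : So13) : unchiral (chiral A) = 1 ⊗ₜ[ℝ] A := by
  have hA : A = ∑ k, (rotation A k • so13Of (Pi.single k 1) 0 +
      boost A k • so13Of 0 (Pi.single k 1)) := by
    refine so13_ext ?_ ?_ <;> ext i <;> fin_cases i <;>
      simp [Fin.sum_univ_three, rotation, boost, so13Of]
  have hr (k) : Complex.I * (pauliCoord (chiral A).1 k + pauliCoord (chiral A).2 k) =
      rotation A k • (1 : ℂ) := by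
    simp only [chiral, LinearMap.coe_mk, AddHom.coe_mk, pauliCoord_pauli, Complex.real_smul]
    linear_combination (-(rotation A k : ℂ)) * Complex.I_mul_I
  have hb (k) : pauliCoord (chiral A).2 k - pauliCoord (chiral A).1 k =
      boost A k • (1 : ℂ) := by
    simp only [chiral, LinearMap.coe_mk, AddHom.coe_mk, pauliCoord_pauli, Complex.real_smul]
    ring
  conv_rhs => rw [hA]
  simp only [unchiral, LinearMap.coe_mk, AddHom.coe_mk, hr, hb, TensorProduct.tmul_sum,
    TensorProduct.tmul_add, TensorProduct.smul_tmul]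

theorem chiralC_tmul (c : ℂ) (A : So13) : chiralC (c ⊗ₜ[ℝ] A) = c • chiral A :=
  LinearMap.liftBaseChange_tmul ..

theorem unchiral_chiralC (x : So13C) : unchiral (chiralC x) = x := by
  induction x using TensorProduct.induction_on with
  | zero => simp
  | add x y hx hy => rw [map_add, map_add, hx, hy]
  | tmul c A =>
    rw [chiralC_tmul, map_smul, unchiral_chiral, TensorProduct.smul_tmul', smul_eq_mul, mul_one]

theorem chiralC_unchiral (x : Sl2 × Sl2) : chiralC (unchiral x) = x := by
  obtain ⟨x, y⟩ := x
  rw [← pauli_pauliCoord x, ← pauli_pauliCoord y]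
  generalize pauliCoord x = a
  generalize pauliCoord y = b
  simp only [unchiral, LinearMap.coe_mk, AddHom.coe_mk, map_add, chiralC_tmul, chiral,
    pauliCoord_pauli, rotation_so13Of, boost_so13Of, Fin.sum_univ_three]
  ext i j <;> fin_cases i <;> fin_cases j <;> simp [pauli] <;> ring_nf <;> simp <;> ring

theorem bijective_chiralC : Function.Bijective chiralC :=
  ⟨Function.LeftInverse.injective unchiral_chiralC,
    Function.RightInverse.surjective chiralC_unchiral⟩

/-! ### Representations of `so(1,3)` and of `so(1,3)_ℂ` -/

section Restrict

variable {V : Type*} [AddCommGroup V] [Module ℂ V]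

theorem apply_tmul (ρ : So13C →ₗ⁅ℂ⁆ Module.End ℂ V) (c : ℂ) (A : So13) :
    ρ (c ⊗ₜ[ℝ] A) = c • restrict ρ A := by
  change _ = c • ρ (1 ⊗ₜ[ℝ] A)
  rw [← map_smul, TensorProduct.smul_tmul', smul_eq_mul, mul_one]

/-- The complex linear extension of a representation of `so(1,3)`. -/
def extend (ρ : So13 →ₗ⁅ℝ⁆ Module.End ℂ V) : So13C →ₗ⁅ℂ⁆ Module.End ℂ V where
  toLinearMap := LinearMap.liftBaseChange ℂ (ρ : So13 →ₗ[ℝ] Module.End ℂ V)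
  map_lie' {x y} := by
    change LinearMap.liftBaseChange ℂ (ρ : So13 →ₗ[ℝ] Module.End ℂ V) ⁅x, y⁆ =
      ⁅LinearMap.liftBaseChange ℂ (ρ : So13 →ₗ[ℝ] Module.End ℂ V) x,
        LinearMap.liftBaseChange ℂ (ρ : So13 →ₗ[ℝ] Module.End ℂ V) y⁆
    induction x using TensorProduct.induction_on with
    | zero => simp
    | add x₁ x₂ h₁ h₂ => rw [add_lie, map_add, map_add, add_lie, h₁, h₂]
    | tmul a A =>
      induction y using TensorProduct.induction_on with
      | zero => rw [show ⁅a ⊗ₜ[ℝ] A, (0 : So13C)⁆ = 0 from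
          lie_zero (L := So13C) (M := So13C) _, map_zero, lie_zero]
      | add y₁ y₂ h₁ h₂ =>
        rw [show ⁅a ⊗ₜ[ℝ] A, y₁ + y₂⁆ = ⁅a ⊗ₜ[ℝ] A, y₁⁆ + ⁅a ⊗ₜ[ℝ] A, y₂⁆ from
          lie_add (L := So13C) (M := So13C) _ _ _,
          map_add, map_add, lie_add, h₁, h₂]
      | tmul b B =>
        simp only [LieAlgebra.ExtendScalars.bracket_tmul, LinearMap.liftBaseChange_tmul,
          LieHom.coe_toLinearMap, LieHom.map_lie, smul_lie, lie_smul, smul_smul, mul_comm a b]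

theorem restrict_extend (ρ : So13 →ₗ⁅ℝ⁆ Module.End ℂ V) : restrict (extend ρ) = ρ := by
  ext1 A
  change LinearMap.liftBaseChange ℂ (ρ : So13 →ₗ[ℝ] Module.End ℂ V) (1 ⊗ₜ[ℝ] A) = ρ A
  rw [LinearMap.liftBaseChange_tmul, one_smul, LieHom.coe_toLinearMap]

theorem bijective_restrict :
    Function.Bijective
      (fun ρ : So13C →ₗ⁅ℂ⁆ Module.End ℂ V => (restrict ρ : So13 →ₗ⁅ℝ⁆ Module.End ℂ V)) := by
  refine ⟨fun ρ σ h => ?_, fun ρ => ⟨extend ρ, restrict_extend ρ⟩⟩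
  have h : restrict ρ = restrict σ := h
  ext1 x
  induction x using TensorProduct.induction_on with
  | zero => simp
  | add x y hx hy => rw [map_add, map_add, hx, hy]
  | tmul c A => rw [apply_tmul, apply_tmul, h]

theorem isIrreducible_restrict (ρ : So13C →ₗ⁅ℂ⁆ Module.End ℂ V) :
    IsIrreducible ⇑(restrict ρ) ↔ IsIrreducible ⇑ρ := by
  refine and_congr_right fun _ => forall_congr' fun W => imp_congr_left ⟨fun h x w hw => ?_,
    fun h A w hw => h _ w hw⟩
  induction x using TensorProduct.induction_on with
  | zero => simp
  | add x y hx hy => rw [map_add]; exact W.add_mem hx hy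
  | tmul c A => rw [apply_tmul]; exact W.smul_mem c (h A w hw)

theorem equivalent_restrict {W : Type*} [AddCommGroup W] [Module ℂ W]
    (ρ : So13C →ₗ⁅ℂ⁆ Module.End ℂ V) (σ : So13C →ₗ⁅ℂ⁆ Module.End ℂ W) :
    Equivalent ⇑(restrict ρ) ⇑(restrict σ) ↔ Equivalent ⇑ρ ⇑σ := by
  refine exists_congr fun T => ⟨fun h x v => ?_, fun h A v => h _ v⟩
  induction x using TensorProduct.induction_on with
  | zero => simp
  | add x y hx hy => simp only [map_add, LinearMap.add_apply, hx, hy]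
  | tmul c A => simp only [apply_tmul, LinearMap.smul_apply, map_smul, h]

end Restrict

/-! ### The classification for `so(1,3)_ℂ` and `so(1,3)` -/

theorem isIrreducible_comp {L L' V : Type*} [AddCommGroup V] [Module ℂ V]
    {ρ : L → Module.End ℂ V} {f : L' → L} (hf : Function.Surjective f) :
    IsIrreducible (ρ ∘ f) ↔ IsIrreducible ρ :=
  and_congr_right fun _ => forall_congr' fun W =>
    imp_congr_left (hf.forall (p := fun x => ∀ w ∈ W, ρ x w ∈ W)).symm

theorem equivalent_comp {L L' V W : Type*} [AddCommGroup V] [Module ℂ V] [AddCommGroup W]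
    [Module ℂ W] {ρ : L → Module.End ℂ V} {σ : L → Module.End ℂ W} {f : L' → L}
    (hf : Function.Surjective f) : Equivalent (ρ ∘ f) (σ ∘ f) ↔ Equivalent ρ σ :=
  exists_congr fun T => (hf.forall (p := fun x => ∀ v, T (ρ x v) = σ x (T v))).symm

theorem isIrreducible_repC (j₁ j₂ : HalfInteger) : IsIrreducible ⇑(repC j₁ j₂) :=
  (isIrreducible_comp bijective_chiralC.2).2 (isIrreducible_pairRep j₁ j₂)

theorem isIrreducible_rep (j₁ j₂ : HalfInteger) : IsIrreducible ⇑(rep j₁ j₂) :=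
  (isIrreducible_restrict _).2 (isIrreducible_repC j₁ j₂)

theorem existsUnique_equivalent_repC {V : Type*} [AddCommGroup V] [Module ℂ V]
    [FiniteDimensional ℂ V] {ρ : So13C →ₗ⁅ℂ⁆ Module.End ℂ V} (hρ : IsIrreducible ⇑ρ) :
    ∃! j : HalfInteger × HalfInteger, Equivalent ⇑ρ ⇑(repC j.1 j.2) := by
  let e := LieEquiv.ofBijective chiralC bijective_chiralC
  let σ : Sl2 × Sl2 →ₗ⁅ℂ⁆ Module.End ℂ V := ρ.comp e.symm
  have hσ : ⇑ρ = ⇑σ ∘ ⇑chiralC := funext fun x => congr_arg ρ (e.symm_apply_apply x).symm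
  rw [hσ, isIrreducible_comp bijective_chiralC.2] at hρ
  convert existsUnique_equivalent_pairRep hρ using 3 with j
  rw [hσ]
  exact equivalent_comp (σ := ⇑(pairRep j.1 j.2)) bijective_chiralC.2

theorem existsUnique_equivalent_rep {V : Type*} [AddCommGroup V] [Module ℂ V]
    [FiniteDimensional ℂ V] {ρ : So13 →ₗ⁅ℝ⁆ Module.End ℂ V} (hρ : IsIrreducible ⇑ρ) :
    ∃! j : HalfInteger × HalfInteger, Equivalent ⇑ρ ⇑(rep j.1 j.2) := by
  obtain ⟨σ, rfl⟩ := bijective_restrict.2 ρ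
  convert existsUnique_equivalent_repC ((isIrreducible_restrict σ).1 hρ) using 3 with j
  exact equivalent_restrict σ (repC j.1 j.2)

theorem finrank_spinSpace_tensor (j₁ j₂ : HalfInteger) :
    (Module.finrank ℂ (SpinSpace j₁ ⊗[ℂ] SpinSpace j₂) : ℚ) =
      (2 * (j₁ : ℚ) + 1) * (2 * (j₂ : ℚ) + 1) := by
  obtain ⟨m, hm⟩ := j₁.2
  obtain ⟨n, hn⟩ := j₂.2
  rw [Module.finrank_tensorProduct, finrank_spinSpace hm, finrank_spinSpace hn, hm, hn]
  push_cast
  ring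

end

end Lorentz

open scoped TensorProduct in
open Lorentz in
theorem mainTheorem7 :
    -- `so(1,3)_ℂ ≅ sl(2, ℂ) × sl(2, ℂ)`, through the complex linear Lie algebra map `chiralC`
    Function.Bijective chiralC ∧
    -- the complex representations of `so(1,3)` are those of `so(1,3)_ℂ`
    (∀ (V : Type*) [AddCommGroup V] [Module ℂ V],
      Function.Bijective
        (fun ρ : So13C →ₗ⁅ℂ⁆ Module.End ℂ V => (restrict ρ : So13 →ₗ⁅ℝ⁆ Module.End ℂ V))) ∧
    (∀ (V : Type*) [AddCommGroup V] [Module ℂ V] (ρ : So13C →ₗ⁅ℂ⁆ Module.End ℂ V),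
      IsIrreducible ⇑(restrict ρ) ↔ IsIrreducible ⇑ρ) ∧
    (∀ (V W : Type*) [AddCommGroup V] [Module ℂ V] [AddCommGroup W] [Module ℂ W]
      (ρ : So13C →ₗ⁅ℂ⁆ Module.End ℂ V) (σ : So13C →ₗ⁅ℂ⁆ Module.End ℂ W),
      Equivalent ⇑(restrict ρ) ⇑(restrict σ) ↔ Equivalent ⇑ρ ⇑σ) ∧
    -- the dimension of `V^{(j₁,j₂)}`
    (∀ j₁ j₂ : HalfInteger,
      FiniteDimensional ℂ (SpinSpace j₁ ⊗[ℂ] SpinSpace j₂) ∧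
      (Module.finrank ℂ (SpinSpace j₁ ⊗[ℂ] SpinSpace j₂) : ℚ) =
        (2 * (j₁ : ℚ) + 1) * (2 * (j₂ : ℚ) + 1)) ∧
    -- the classification for `so(1,3)`
    (∀ j₁ j₂ : HalfInteger, IsIrreducible ⇑(rep j₁ j₂)) ∧
    (∀ (V : Type*) [AddCommGroup V] [Module ℂ V] [FiniteDimensional ℂ V]
      (ρ : So13 →ₗ⁅ℝ⁆ Module.End ℂ V), IsIrreducible ⇑ρ →
        ∃! j : HalfInteger × HalfInteger, Equivalent ⇑ρ ⇑(rep j.1 j.2)) ∧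
    -- the classification for `so(1,3)_ℂ`
    (∀ j₁ j₂ : HalfInteger, IsIrreducible ⇑(repC j₁ j₂)) ∧
    (∀ (V : Type*) [AddCommGroup V] [Module ℂ V] [FiniteDimensional ℂ V]
      (ρ : So13C →ₗ⁅ℂ⁆ Module.End ℂ V), IsIrreducible ⇑ρ →
        ∃! j : HalfInteger × HalfInteger, Equivalent ⇑ρ ⇑(repC j.1 j.2)) ∧
    -- the classification for `sl(2, ℂ) × sl(2, ℂ)`
    (∀ j₁ j₂ : HalfInteger, IsIrreducible ⇑(pairRep j₁ j₂)) ∧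
    (∀ (V : Type*) [AddCommGroup V] [Module ℂ V] [FiniteDimensional ℂ V]
      (ρ : Sl2 × Sl2 →ₗ⁅ℂ⁆ Module.End ℂ V), IsIrreducible ⇑ρ →
        ∃! j : HalfInteger × HalfInteger, Equivalent ⇑ρ ⇑(pairRep j.1 j.2)) := by
  exact ⟨bijective_chiralC, fun V _ _ => bijective_restrict,
    fun V _ _ ρ => isIrreducible_restrict ρ, fun V W _ _ _ _ ρ σ => equivalent_restrict ρ σ,
    fun j₁ j₂ => ⟨inferInstance, finrank_spinSpace_tensor j₁ j₂⟩,
    isIrreducible_rep, fun V _ _ _ ρ hρ => existsUnique_equivalent_rep hρ,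
    isIrreducible_repC, fun V _ _ _ ρ hρ => existsUnique_equivalent_repC hρ,
    isIrreducible_pairRep, fun V _ _ _ ρ hρ => existsUnique_equivalent_pairRep hρ⟩
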